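/- Let $\mathbb D=\{z\in\mathbb C:|z|<1\}$, and let $\mathcal A$ be the class of analytic functions $f$ on $\mathbb D$ of the form $f(z)=z+\sum_{n\ge 2}a_nz^n$. For analytic functions $h,g$ on $\mathbb D$ write $h\prec g$ if $h(z)=g(w(z))$ on $\mathbb D$ for some analytic $w:\mathbb D\to\mathbb C$ with $w(0)=0$ and $|w(z)|\le|z|$. Let $\mathcal C_{\mathcal B}$ be the class of all $f\in\mathcal A$ with $f'\neq 0$ on $\mathbb D$ and $$1+\frac{zf''(z)}{f'(z)}\prec\sqrt{1+\tanh z},$$ where the square root is the principal branch. For $f\in\mathcal A$ let $$H_2(3)=\begin{vmatrix}a_3&a_4\\a_4&a_5\end{vmatrix}=a_3a_5-a_4^2 .$$ **Theorem.** For every $f\in\mathcal C_{\mathcal B}$, one has $|H_2(3)|\le \dfrac1{576}$. The bound is sharp: the function $$f_1(z)=\int_0^z\exp\left(\int_0^t\frac{\sqrt{1+\tanh u^3}-1}{u}\,du\right)dt$$ belongs to $\mathcal C_{\mathcal B}$, and for $f=f_1$ one has $|H_2(3)|=\dfrac1{576}$. -/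

import Mathlib

namespace BeanConvex

/-- The open unit disk `𝔻` in `ℂ`. -/
def unitDisk : Set ℂ := Metric.ball (0 : ℂ) 1

/-- The class `𝒜` of analytic functions on the unit disk, normalized by `f 0 = 0`, `f' 0 = 1`,
that is, with an expansion `f z = z + a₂ z² + a₃ z³ + ⋯`. -/
def classA : Set (ℂ → ℂ) :=
  {f | DifferentiableOn ℂ f unitDisk ∧ f 0 = 0 ∧ deriv f 0 = 1}

/-- The `n`-th Taylor coefficient `a_n` of `f` at the origin. -/
noncomputable def coeff (f : ℂ → ℂ) (n : ℕ) : ℂ :=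
  iteratedDeriv n f 0 / (n.factorial : ℂ)

/-- The Hankel determinant `H_q(n)`: the determinant of the `q × q` matrix with entries
`a_{n+i+j}`, `0 ≤ i, j < q`. -/
noncomputable def hankelDet (f : ℂ → ℂ) (q n : ℕ) : ℂ :=
  (Matrix.of fun i j : Fin q => coeff f (n + (i : ℕ) + (j : ℕ))).det

theorem hankelDet_two_three (f : ℂ → ℂ) :
    hankelDet f 2 3 = coeff f 3 * coeff f 5 - coeff f 4 ^ 2 := by
  simp [hankelDet, Matrix.det_fin_two, sq]

/-- A Schwarz function: analytic on the unit disk, with `w 0 = 0` and `|w z| ≤ |z|` there. -/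
def IsSchwarz (w : ℂ → ℂ) : Prop :=
  DifferentiableOn ℂ w unitDisk ∧ w 0 = 0 ∧ ∀ z ∈ unitDisk, ‖w z‖ ≤ ‖z‖

/-- Subordination `h ≺ g` of analytic functions on the unit disk: `h = g ∘ w` on the disk for
some Schwarz function `w`. -/
def Subordinate (h g : ℂ → ℂ) : Prop :=
  DifferentiableOn ℂ h unitDisk ∧ DifferentiableOn ℂ g unitDisk ∧
    ∃ w : ℂ → ℂ, IsSchwarz w ∧ ∀ z ∈ unitDisk, h z = g (w z)

/-- The bean function `z ↦ √(1 + tanh z)`, with the principal square root. For `|z| < 1` the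
number `1 + tanh z` lies off the closed negative real axis, so that this is the analytic branch
with value `1` at the origin. -/
noncomputable def bean (z : ℂ) : ℂ := Complex.sqrt (1 + Complex.tanh z)

/-- The class `𝒞_ℬ` of all `f ∈ 𝒜` with `1 + z f''(z) / f'(z) ≺ √(1 + tanh z)`. The condition
that `f'` has no zero in the disk is what gives the quotient a meaning as an analytic function. -/
def classCB : Set (ℂ → ℂ) :=
  {f | f ∈ classA ∧ (∀ z ∈ unitDisk, deriv f z ≠ 0) ∧
    Subordinate (fun z => 1 + z * deriv (deriv f) z / deriv f z) bean}

/-- The integral `∫₀ᶻ g(t) dt` along the segment from `0` to `z`. -/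
noncomputable def segIntegral (g : ℂ → ℂ) (z : ℂ) : ℂ :=
  ∫ s in (0 : ℝ)..1, z * g ((s : ℂ) * z)

/-- The function
`f₁(z) = ∫₀ᶻ exp (∫₀ᵗ (√(1 + tanh u³) - 1) / u du) dt`. -/
noncomputable def extremalFun (z : ℂ) : ℂ :=
  segIntegral
    (fun t => Complex.exp (segIntegral (fun u => (bean (u ^ 3) - 1) / u) t)) z

end BeanConvex

/-! ### The real inequality behind the bound -/

namespace BeanConvex
-- Let w = ∑ bₖ zᵏ be the Schwarz function of f and p = `bean` ∘ w. Then p² (1 + e^(-2w)) = 2 and (z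
-- f')' = p f'. Comparing power series gives a₃, a₄, a₅, and hence 576 H₂(3), as polynomials in b₁,
-- …, b₄ (`coeff_formulas`, `hankelDet_eq`). Since |w| ≤ 1, Bessel's inequality gives ∑ |bₖ|² ≤ 1
-- (`IsSchwarz.sum_sq_norm_coeff_le`). No finer relation between Schwarz coefficients is needed:
-- after the triangle inequality the moduli c, x, u, v of b₁, …, b₄ are controlled by
-- `hankel_real_bound`. Equality occurs there at u = 1, c = x = v = 0. This is w = z³, which yields
-- `extremalFun`.
theorem hankel_real_bound {c x u v : ℝ} (hc : 0 ≤ c) (hx : 0 ≤ x)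
    (h : c ^ 2 + x ^ 2 + u ^ 2 + v ^ 2 ≤ 1) :
    3 / 5 * (4 * x + c ^ 2) * (v / 2 + c * u / 12 + 5 / 12 * c ^ 2 * x + 11 / 288 * c ^ 4) +
      (u + c * x / 4 + 13 / 48 * c ^ 3) ^ 2 ≤ 1 := by
  have hc1 : c ≤ 1 := by nlinarith
  have hc2 : c ^ 2 ≤ 1 := pow_le_one₀ hc hc1
  have hcx : 0 ≤ c * x := mul_nonneg hc hx
  -- The bracket collects, with coefficients rounded up, the factors of `c * x` left over in the
  -- expansion.
  have hK : 7 / 10 * u + 9 / 50 * c + 12 / 25 * c ^ 3 + 77 / 100 * (c * x) ≤ 61 / 50 := by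
    have h3 : c ^ 3 ≤ c := by nlinarith
    -- The point c = 22/25, u = 12/25 is close to where the left side is largest once c x is
    -- replaced by (c² + x²)/2.
    nlinarith [sq_nonneg (c - x), sq_nonneg (c - 22 / 25), sq_nonneg (u - 12 / 25)]
  have hcu : 2 * (c * u) ≤ 1 - x ^ 2 := by nlinarith [sq_nonneg (c - u), sq_nonneg v]
  have e1 : c ^ 2 * (2 * (c * u)) ≤ c ^ 2 * (1 - x ^ 2) := by gcongr
  have e2 : c * x * (7 / 10 * u + 9 / 50 * c + 12 / 25 * c ^ 3 + 77 / 100 * (c * x)) ≤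
      c * x * (61 / 50) := by gcongr
  have e3 : c ^ 2 * c ^ 2 ≤ c ^ 2 * 1 := by gcongr
  have e4 : c ^ 2 * c ^ 4 ≤ c ^ 2 * 1 := by
    gcongr
    exact pow_le_one₀ hc hc1
  have e5 : 0 ≤ c ^ 4 * x := by positivity
  -- The first square absorbs the terms in v at the cost v² + (3x/5 + 3c²/20)², leaving 16x²/25 of
  -- the budget x². The second bounds 61cx/50 by that 16x²/25 plus (61/80)² c². The term in c³u is
  -- handled by `e1`, and the coefficients of c² then sum to slightly less than 1.
  nlinarith [sq_nonneg (v - 3 / 5 * x - 3 / 20 * c ^ 2), sq_nonneg (4 / 5 * x - 61 / 80 * c)]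

end BeanConvex

/-! ### Taylor series at the origin and the coefficient formulas -/

namespace BeanConvex
open Filter Topology

/-- The Taylor series at the origin, as a formal power series. -/
noncomputable def taylorSeries (f : ℂ → ℂ) : PowerSeries ℂ := PowerSeries.mk (coeff f)

@[simp] theorem coeff_taylorSeries (f : ℂ → ℂ) (n : ℕ) :
    PowerSeries.coeff n (taylorSeries f) = coeff f n := by
  simp [taylorSeries]

theorem coeff_zero_eq (f : ℂ → ℂ) : coeff f 0 = f 0 := by simp [coeff]

theorem coeff_one_eq (f : ℂ → ℂ) : coeff f 1 = deriv f 0 := by simp [coeff]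

theorem taylorSeries_congr {f g : ℂ → ℂ} (h : f =ᶠ[𝓝 0] g) :
    taylorSeries f = taylorSeries g := by
  ext n
  simp [coeff, h.iteratedDeriv_eq]

theorem taylorSeries_mul {f g : ℂ → ℂ} (hf : AnalyticAt ℂ f 0) (hg : AnalyticAt ℂ g 0) :
    taylorSeries (f * g) = taylorSeries f * taylorSeries g := by
  ext n
  simp only [coeff_taylorSeries, coeff, iteratedDeriv_mul hf.contDiffAt hg.contDiffAt,
    PowerSeries.coeff_mul, Finset.Nat.sum_antidiagonal_eq_sum_range_succ_mk, Finset.sum_div]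
  refine Finset.sum_congr rfl fun i hi ↦ ?_
  rw [Nat.cast_choose _ (by grind)]
  field_simp [Nat.factorial_ne_zero]

theorem taylorSeries_add {f g : ℂ → ℂ} (hf : AnalyticAt ℂ f 0) (hg : AnalyticAt ℂ g 0) :
    taylorSeries (f + g) = taylorSeries f + taylorSeries g := by
  ext n
  simp [coeff, iteratedDeriv_add hf.contDiffAt hg.contDiffAt, add_div]

theorem taylorSeries_const (a : ℂ) :
    taylorSeries (fun _ => a) = PowerSeries.C a := by
  ext n
  rcases n with _ | n <;> simp [coeff, iteratedDeriv_const, PowerSeries.coeff_C]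

theorem coeff_deriv (f : ℂ → ℂ) (n : ℕ) : coeff (deriv f) n = (n + 1) * coeff f (n + 1) := by
  simp only [coeff, ← iteratedDeriv_succ', Nat.factorial_succ]
  push_cast
  have : (n : ℂ) + 1 ≠ 0 := by exact_mod_cast n.succ_ne_zero
  field_simp [Nat.factorial_ne_zero]

theorem taylorSeries_id : taylorSeries (fun z => z) = PowerSeries.X := by
  ext n
  rcases n with _ | n
  · simp [coeff]
  · have := coeff_deriv (fun z => z) n
    have h1 : coeff (deriv fun z : ℂ => z) n = if n = 0 then 1 else 0 := by
      rw [show (deriv fun z : ℂ => z) = fun _ => 1 by ext; simp, ← coeff_taylorSeries,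
        taylorSeries_const, PowerSeries.coeff_C]
    rw [h1] at this
    rcases n with _ | n
    · simpa [PowerSeries.coeff_X] using this.symm
    · have h2 : (n : ℂ) + 1 + 1 ≠ 0 := by exact_mod_cast (n + 1).succ_ne_zero
      simpa [PowerSeries.coeff_X, h2] using this

/-- The Taylor coefficients of `f` in terms of those of the Schwarz function `w`. -/
theorem coeff_formulas {f w p : ℂ → ℂ} (hf : AnalyticAt ℂ f 0) (hw : AnalyticAt ℂ w 0)
    (hp : AnalyticAt ℂ p 0) (hf1 : deriv f 0 = 1) (hw0 : w 0 = 0) (hp0 : p 0 = 1)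
    (hpw : ∀ᶠ z in 𝓝 0, p z * p z * (1 + Complex.exp (-2 * w z)) = 2)
    (hfp : ∀ᶠ z in 𝓝 0, z * deriv (deriv f) z + deriv f z = p z * deriv f z) :
    coeff f 3 = (4 * coeff w 2 + coeff w 1 ^ 2) / 48 ∧
    coeff f 4 = (coeff w 3 / 2 + coeff w 1 * coeff w 2 / 8 - 13 / 96 * coeff w 1 ^ 3) / 12 ∧
    coeff f 5 = (coeff w 4 / 2 + coeff w 1 * coeff w 3 / 12 - 5 / 12 * coeff w 1 ^ 2 * coeff w 2
      - 11 / 288 * coeff w 1 ^ 4) / 20 := by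
  set E : ℂ → ℂ := fun z => Complex.exp (-2 * w z) with hE
  have hEa : AnalyticAt ℂ E 0 := (analyticAt_const.mul hw).cexp
  have hdE : deriv E =ᶠ[𝓝 0] (fun _ => -2) * deriv w * E := by
    filter_upwards [hw.eventually_analyticAt] with z hz
    have := ((hz.differentiableAt.hasDerivAt.const_mul (-2)).cexp).deriv
    simp only [hE, Pi.mul_apply]
    rw [this]
    ring
  -- The relations E' = -2w'E, p²(1 + E) = 2 and zf'' + f' = pf' become identities of formal power
  -- series. They form a triangular system, solved successively for the coefficients of E, p and f,
  -- so neither the square root nor tanh is ever expanded.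
  have tE := taylorSeries_congr hdE
  rw [taylorSeries_mul (analyticAt_const.mul hw.deriv) hEa,
    taylorSeries_mul analyticAt_const hw.deriv, taylorSeries_const, mul_assoc] at tE
  have tP := taylorSeries_congr (f := p * p * ((fun _ => 1) + E)) (g := fun _ => 2)
    (hpw.mono fun _ h => h)
  rw [taylorSeries_mul (hp.mul hp) (analyticAt_const.add hEa), taylorSeries_mul hp hp,
    taylorSeries_add analyticAt_const hEa, taylorSeries_const, taylorSeries_const, mul_assoc] at tP
  have hid : AnalyticAt ℂ (fun z : ℂ => z) 0 := analyticAt_id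
  have tF := taylorSeries_congr (f := (fun z => z) * deriv (deriv f) + deriv f)
    (g := p * deriv f) (hfp.mono fun _ h => h)
  rw [taylorSeries_add (hid.mul hf.deriv.deriv) hf.deriv,
    taylorSeries_mul hid hf.deriv.deriv,
    taylorSeries_mul hp hf.deriv, taylorSeries_id] at tF
  have cE n := congrArg (PowerSeries.coeff n) tE
  have cP n := congrArg (PowerSeries.coeff (n + 1)) tP
  have cF n := congrArg (PowerSeries.coeff (n + 1)) tF
  simp only [PowerSeries.coeff_C_mul, map_add, PowerSeries.coeff_succ_X_mul] at cE cP cF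
  simp only [PowerSeries.coeff_mul, map_add, coeff_taylorSeries, coeff_deriv, PowerSeries.coeff_C] at cE cP cF
  have w0 : coeff w 0 = 0 := by rw [coeff_zero_eq, hw0]
  have p0 : coeff p 0 = 1 := by rw [coeff_zero_eq, hp0]
  have f1 : coeff f 1 = 1 := by rw [coeff_one_eq, hf1]
  have e0 : coeff E 0 = 1 := by rw [coeff_zero_eq]; simp [hE, hw0]
  have cE0 := cE 0
  have cE1 := cE 1
  have cE2 := cE 2
  have cE3 := cE 3
  have cP0 := cP 0
  have cP1 := cP 1
  have cP2 := cP 2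
  have cP3 := cP 3
  have cF0 := cF 0
  have cF1 := cF 1
  have cF2 := cF 2
  have cF3 := cF 3
  clear cE cP cF
  norm_num [Finset.Nat.antidiagonal_succ, w0, p0, f1, e0] at cE0 cE1 cE2 cE3 cP0 cP1 cP2 cP3
  norm_num [Finset.Nat.antidiagonal_succ, p0, f1] at cF0 cF1 cF2 cF3
  generalize coeff w 1 = b1 at *
  generalize coeff w 2 = b2 at *
  generalize coeff w 3 = b3 at *
  generalize coeff w 4 = b4 at *
  have e2 : coeff E 2 = 2 * b1 ^ 2 - 2 * b2 := by rw [cE0] at cE1; linear_combination cE1 / 2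
  have e3 : coeff E 3 = -2 * b3 + 4 * b1 * b2 - 4 / 3 * b1 ^ 3 := by
    rw [cE0, e2] at cE2; linear_combination cE2 / 3
  have e4 : coeff E 4 = -2 * b4 + 4 * b1 * b3 + 2 * b2 ^ 2 - 4 * b1 ^ 2 * b2 + 2 / 3 * b1 ^ 4 := by
    rw [cE0, e2, e3] at cE3; linear_combination cE3 / 4
  rw [cE0] at cP0
  have p1 : coeff p 1 = b1 / 2 := by linear_combination cP0 / 4
  rw [cE0, e2, p1] at cP1
  have p2 : coeff p 2 = b2 / 2 - b1 ^ 2 / 8 := by linear_combination cP1 / 4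
  rw [cE0, e2, e3, p1, p2] at cP2
  have p3 : coeff p 3 = b3 / 2 - b1 * b2 / 4 - 5 / 48 * b1 ^ 3 := by linear_combination cP2 / 4
  rw [cE0, e2, e3, e4, p1, p2, p3] at cP3
  have p4 : coeff p 4 = b4 / 2 - b1 * b3 / 4 - b2 ^ 2 / 8 - 5 / 16 * b1 ^ 2 * b2
      + 17 / 384 * b1 ^ 4 := by linear_combination cP3 / 4
  rw [p1] at cF0
  have f2 : coeff f 2 = b1 / 4 := by linear_combination cF0 / 2
  rw [p1, p2, f2] at cF1
  have f3 : coeff f 3 = (4 * b2 + b1 ^ 2) / 48 := by linear_combination cF1 / 6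
  rw [p1, p2, p3, f2, f3] at cF2
  have f4 : coeff f 4 = (b3 / 2 + b1 * b2 / 8 - 13 / 96 * b1 ^ 3) / 12 := by
    linear_combination cF2 / 12
  rw [p1, p2, p3, p4, f2, f3, f4] at cF3
  refine ⟨f3, f4, ?_⟩
  linear_combination cF3 / 20

end BeanConvex

/-! ### Bessel's inequality for Schwarz functions -/

namespace BeanConvex
open Filter Topology Metric Real

theorem circleAverage_inv_pow_mul {f : ℂ → ℂ} {r : ℝ} (hr : 0 < r)
    (hf : DifferentiableOn ℂ f (closedBall 0 r)) (n : ℕ) :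
    circleAverage (fun z => (z ^ n)⁻¹ * f z) 0 r = coeff f n := by
  have h := hf.circleIntegral_one_div_sub_center_pow_smul hr n
  rw [circleAverage_eq_circleIntegral hr.ne', coeff]
  have h2 : ∮ z in C(0, r), (z - 0)⁻¹ • ((z ^ n)⁻¹ * f z) =
      ∮ z in C(0, r), (1 / (z - 0) ^ (n + 1)) • f z := by
    congr 1
    ext z
    simp only [sub_zero, smul_eq_mul, one_div, pow_succ, mul_inv]
    ring
  rw [h2, h]
  simp only [smul_eq_mul]
  field_simp [Complex.two_pi_I_ne_zero, Nat.factorial_ne_zero]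

/-- **Bessel's inequality** for the Taylor coefficients of an analytic function on a disk. -/
theorem sum_sq_norm_coeff_mul_le {f : ℂ → ℂ} {r : ℝ} (hr : 0 < r)
    (hf : DifferentiableOn ℂ f (closedBall 0 r)) (h1 : ∀ z ∈ closedBall (0 : ℂ) r, ‖f z‖ ≤ 1)
    (N : ℕ) : ∑ k ∈ Finset.range N, ‖coeff f k‖ ^ 2 * r ^ (2 * k) ≤ 1 := by
  set Q : ℂ → ℂ := fun z => ∑ k ∈ Finset.range N, coeff f k * z ^ k with hQ
  have hQd : Differentiable ℂ Q := by fun_prop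
  have hpow (k : ℕ) : taylorSeries (fun z => z ^ k) = PowerSeries.X ^ k := by
    induction k with
    | zero => simp [taylorSeries_const]
    | succ k ih =>
      rw [pow_succ, ← ih, ← taylorSeries_id, ← taylorSeries_mul (by fun_prop) (by fun_prop)]
      congr 1
  have hQc : ∀ k ∈ Finset.range N, coeff Q k = coeff f k := by
    intro k hk
    have hs : ∀ s : Finset ℕ, taylorSeries (fun z => ∑ k ∈ s, coeff f k * z ^ k) =
        ∑ k ∈ s, PowerSeries.C (coeff f k) * PowerSeries.X ^ k := by
      intro s
      induction s using Finset.induction_on with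
      | empty => simp [taylorSeries_const]
      | insert a s ha ih =>
        rw [Finset.sum_insert ha, ← ih, ← hpow, ← taylorSeries_const,
          ← taylorSeries_mul (by fun_prop) (by fun_prop), ← taylorSeries_add]
        · congr 1
          ext z
          simp [Finset.sum_insert ha]
        · fun_prop
        · exact (Differentiable.analyticAt (by fun_prop) 0)
    rw [← coeff_taylorSeries, hs]
    simp only [map_sum, PowerSeries.coeff_C_mul, PowerSeries.coeff_X_pow]
    simp [Finset.mem_range.1 hk]
  -- Pointwise, Re(conj Q · (2f - Q)) = |f|² - |f - Q|² ≤ 1. The coefficients of g below N agree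
  -- with those of f, so the circle average of conj Q · g is exactly the sum to be bounded.
  set g : ℂ → ℂ := fun z => 2 * f z - Q z with hg
  have hgd : DifferentiableOn ℂ g (closedBall 0 r) := (hf.const_mul 2).sub hQd.differentiableOn
  have hfa : AnalyticAt ℂ f 0 := hf.analyticAt (closedBall_mem_nhds 0 hr)
  have hgc : ∀ k ∈ Finset.range N, coeff g k = coeff f k := by
    intro k hk
    have : taylorSeries g + taylorSeries Q = PowerSeries.C 2 * taylorSeries f := by
      rw [← taylorSeries_const, ← taylorSeries_mul analyticAt_const hfa, ← taylorSeries_add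
        (hgd.analyticAt (closedBall_mem_nhds 0 hr)) (hQd.analyticAt 0)]
      congr 1
      ext z
      simp [hg]
    have := congrArg (PowerSeries.coeff k) this
    simp only [map_add, coeff_taylorSeries, PowerSeries.coeff_C_mul, hQc k hk] at this
    linear_combination this
  have hci (k : ℕ) : CircleIntegrable (fun z => (z ^ k)⁻¹ * g z) 0 r := by
    refine ContinuousOn.circleIntegrable hr.le (ContinuousOn.mul ?_ ?_)
    · refine (continuousOn_id.pow k).inv₀ fun z hz => pow_ne_zero _ ?_
      rintro rfl
      simp [hr.ne] at hz
    · exact hgd.continuousOn.mono sphere_subset_closedBall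
  set T : ℂ → ℂ := fun z => ∑ k ∈ Finset.range N,
    ((starRingEnd ℂ) (coeff f k) * r ^ (2 * k)) • ((z ^ k)⁻¹ * g z) with hT
  have hci' (k : ℕ) : CircleIntegrable (fun z =>
      ((starRingEnd ℂ) (coeff f k) * r ^ (2 * k)) • ((z ^ k)⁻¹ * g z)) 0 r := (hci k).const_smul
  have hTi : CircleIntegrable T 0 r := CircleIntegrable.fun_sum _ fun k _ => hci' k
  have hTavg : circleAverage T 0 r =
      ((∑ k ∈ Finset.range N, ‖coeff f k‖ ^ 2 * r ^ (2 * k) : ℝ) : ℂ) := by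
    rw [hT, circleAverage_fun_sum fun k _ => hci' k]
    push_cast
    refine Finset.sum_congr rfl fun k hk => ?_
    rw [circleAverage_fun_smul, circleAverage_inv_pow_mul hr hgd, hgc k hk, smul_eq_mul,
      ← Complex.conj_mul']
    ring
  have hre := Complex.reCLM.circleAverage_comp_comm hTi
  rw [hTavg, Complex.reCLM_apply, Complex.ofReal_re] at hre
  rw [← hre]
  refine circleAverage_mono_on_of_le_circle ?_ ?_
  · exact ⟨Complex.reCLM.integrable_comp hTi.1, Complex.reCLM.integrable_comp hTi.2⟩
  · intro z hz
    rw [abs_of_pos hr] at hz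
    have hz0 : z ≠ 0 := by
      rintro rfl
      simp [hr.ne] at hz
    -- On the circle conj(z)ᵏ = r²ᵏ z⁻ᵏ, which turns T into conj Q · g.
    have hzr : (r : ℂ) ^ 2 = z * (starRingEnd ℂ) z := by
      rw [Complex.mul_conj', ← mem_sphere_zero_iff_norm.1 hz]
    have hTz : T z = (starRingEnd ℂ) (Q z) * g z := by
      simp only [hT, hQ, map_sum, map_mul, map_pow, Finset.sum_mul, smul_eq_mul]
      refine Finset.sum_congr rfl fun k _ => ?_
      rw [pow_mul, hzr, mul_pow]
      field_simp
    have hf1 := h1 z (sphere_subset_closedBall hz)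
    have hf2 : ‖f z‖ ^ 2 ≤ 1 := pow_le_one₀ (norm_nonneg _) hf1
    rw [← Complex.normSq_eq_norm_sq, Complex.normSq_apply] at hf2
    simp only [Function.comp, Complex.reCLM_apply, hTz, hg, Complex.mul_re, Complex.conj_re,
      Complex.conj_im, Complex.sub_re, Complex.sub_im, Complex.mul_im, Complex.re_ofNat,
      Complex.im_ofNat]
    nlinarith [sq_nonneg ((f z).re - (Q z).re), sq_nonneg ((f z).im - (Q z).im)]

theorem IsSchwarz.sum_sq_norm_coeff_le {w : ℂ → ℂ} (hw : IsSchwarz w) (N : ℕ) :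
    ∑ k ∈ Finset.range N, ‖coeff w k‖ ^ 2 ≤ 1 := by
  obtain ⟨hd, -, hb⟩ := hw
  -- The disk is open, so the inequality is applied on radius r < 1 and r tends to 1.
  have hlim : Tendsto (fun r : ℝ => ∑ k ∈ Finset.range N, ‖coeff w k‖ ^ 2 * r ^ (2 * k))
      (𝓝[<] 1) (𝓝 (∑ k ∈ Finset.range N, ‖coeff w k‖ ^ 2 * 1 ^ (2 * k))) :=
    (Continuous.tendsto (by fun_prop) 1).mono_left nhdsWithin_le_nhds
  simp only [one_pow, mul_one] at hlim
  refine le_of_tendsto hlim ?_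
  filter_upwards [Ioo_mem_nhdsLT (zero_lt_one' ℝ)] with r hr
  have hsub : closedBall (0 : ℂ) r ⊆ unitDisk := closedBall_subset_ball hr.2
  refine sum_sq_norm_coeff_mul_le hr.1 (hd.mono hsub) (fun z hz => ?_) N
  exact (hb z (hsub hz)).trans (by simpa using (mem_closedBall_zero_iff.1 hz).trans hr.2.le)

end BeanConvex

/-! ### Analyticity of the bean function -/

namespace BeanConvex
open Filter Topology Metric Complex

theorem zero_mem_unitDisk : (0 : ℂ) ∈ unitDisk := mem_ball_self one_pos

theorem unitDisk_mem_nhds : unitDisk ∈ 𝓝 (0 : ℂ) := ball_mem_nhds 0 one_pos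

theorem exp_neg_two_mul_mem_slitPlane {z : ℂ} (hz : z ∈ unitDisk) :
    exp (-2 * z) ∈ slitPlane := by
  have h : |z.im| < 1 := (abs_im_le_norm z).trans_lt (mem_ball_zero_iff.1 hz)
  have h2 := abs_lt.1 h
  -- As |Im(-2z)| < 2 < π, the exponential avoids the closed negative real axis.
  have hpi := Real.pi_gt_three
  refine expOpenPartialHomeomorph.map_source (x := -2 * z) ?_
  simp [expOpenPartialHomeomorph]
  constructor <;> linarith

theorem one_add_exp_mem_slitPlane {z : ℂ} (hz : z ∈ unitDisk) :
    1 + exp (-2 * z) ∈ slitPlane := by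
  have h := exp_neg_two_mul_mem_slitPlane hz
  rw [mem_slitPlane_iff] at h ⊢
  simp only [add_re, add_im, one_re, one_im, zero_add]
  exact h.imp (fun h => by linarith) id

/-- In this form the slit plane is easy to reach: it is preserved by adding 1, by inversion and by
positive scaling. -/
theorem one_add_tanh_eq {z : ℂ} (hz : z ∈ unitDisk) :
    1 + tanh z = 2 * (1 + exp (-2 * z))⁻¹ := by
  have h0 := slitPlane_ne_zero (one_add_exp_mem_slitPlane hz)
  have he : exp (-2 * z) = exp (-z) * exp (-z) := by rw [← Complex.exp_add]; ring_nf
  have hi : exp z * exp (-z) = 1 := by rw [← Complex.exp_add]; simp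
  have hc : exp z + exp (-z) = exp z * (1 + exp (-2 * z)) := by
    rw [he]; linear_combination (-exp (-z)) * hi
  have hs : exp z + exp (-z) ≠ 0 := by
    rw [hc]; exact mul_ne_zero (exp_ne_zero z) h0
  have ht : tanh z = (exp z - exp (-z)) / (exp z + exp (-z)) := by
    rw [tanh_eq_sinh_div_cosh, sinh, cosh]
    field_simp
  rw [ht, eq_mul_inv_iff_mul_eq₀ h0, one_add_div hs, div_mul_eq_mul_div, div_eq_iff hs]
  linear_combination (-2) * hc

theorem one_add_tanh_mem_slitPlane {z : ℂ} (hz : z ∈ unitDisk) : 1 + tanh z ∈ slitPlane := by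
  rw [one_add_tanh_eq hz]
  have h := one_add_exp_mem_slitPlane hz
  have h0 := normSq_pos.2 (slitPlane_ne_zero h)
  rw [mem_slitPlane_iff] at h ⊢
  generalize 1 + exp (-2 * z) = E at h h0
  simp only [mul_re, mul_im, re_ofNat, im_ofNat, inv_re, inv_im, zero_mul, sub_zero, add_zero]
  refine h.imp (fun h => by positivity) fun h => ?_
  simp [h, h0.ne']

theorem differentiableOn_bean : DifferentiableOn ℂ bean unitDisk := by
  have h : DifferentiableOn ℂ (fun z => 1 + tanh z) unitDisk := by
    refine DifferentiableOn.congr (f := fun z => 2 * (1 + exp (-2 * z))⁻¹) ?_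
      fun z hz => one_add_tanh_eq hz
    refine DifferentiableOn.const_mul (DifferentiableOn.inv (by fun_prop) fun z hz => ?_) 2
    exact slitPlane_ne_zero (one_add_exp_mem_slitPlane hz)
  exact differentiableOn_sqrt.comp h fun z hz => one_add_tanh_mem_slitPlane hz

theorem bean_zero : bean 0 = 1 := by simp [bean]

theorem bean_mul_self {z : ℂ} (hz : z ∈ unitDisk) :
    bean z * bean z * (1 + exp (-2 * z)) = 2 := by
  have h0 := slitPlane_ne_zero (one_add_exp_mem_slitPlane hz)
  have : bean z * bean z = 1 + tanh z := by
    rw [bean, Complex.sqrt, ← sq]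
    exact_mod_cast cpow_nat_inv_pow (1 + tanh z) two_ne_zero
  rw [this, one_add_tanh_eq hz, mul_assoc, inv_mul_cancel₀ h0, mul_one]

/-! ### Segment integrals and the extremal function -/

theorem hasDerivAt_segIntegral {g : ℂ → ℂ} (hg : DifferentiableOn ℂ g unitDisk) {z : ℂ}
    (hz : z ∈ unitDisk) : HasDerivAt (segIntegral g) (g z) z := by
  obtain ⟨G, hG⟩ := hg.isExactOn_ball
  have key : ∀ y ∈ unitDisk, segIntegral g y = G y - G 0 := by
    intro y hy
    have hmem : ∀ s ∈ Set.uIcc (0 : ℝ) 1, (s : ℂ) * y ∈ unitDisk := by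
      intro s hs
      rw [Set.uIcc_of_le zero_le_one] at hs
      rw [unitDisk, mem_ball_zero_iff] at hy ⊢
      rw [norm_mul, norm_real, Real.norm_of_nonneg hs.1]
      exact (mul_le_of_le_one_left (norm_nonneg y) hs.2).trans_lt hy
    have hlin (s : ℝ) : HasDerivAt (fun s : ℝ => (s : ℂ) * y) y s := by
      simpa using (ofRealCLM.hasDerivAt (x := s)).mul_const y
    have h := intervalIntegral.integral_eq_sub_of_hasDerivAt (a := 0) (b := 1)
      (f := fun s : ℝ => G ((s : ℂ) * y)) (f' := fun s : ℝ => y * g ((s : ℂ) * y))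
      (fun s hs => ((hG _ (hmem s hs)).comp_of_eq s (hlin s) rfl).congr_deriv (mul_comm _ _))
      (by
        refine ContinuousOn.intervalIntegrable (continuousOn_const.mul ?_)
        exact hg.continuousOn.comp (by fun_prop) hmem)
    simpa [segIntegral] using h
  refine ((hG z hz).sub_const (G 0)).congr_of_eventuallyEq ?_
  filter_upwards [isOpen_ball.mem_nhds hz] with y hy using key y hy

theorem cube_mem_unitDisk {z : ℂ} (hz : z ∈ unitDisk) : z ^ 3 ∈ unitDisk := by
  rw [unitDisk, mem_ball_zero_iff] at hz ⊢
  rw [norm_pow]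
  exact pow_lt_one₀ (norm_nonneg z) hz three_ne_zero

theorem isSchwarz_cube : IsSchwarz fun z => z ^ 3 := by
  refine ⟨by fun_prop, by simp, fun z hz => ?_⟩
  rw [norm_pow]
  exact pow_le_of_le_one (norm_nonneg z) (mem_ball_zero_iff.1 hz).le three_ne_zero

theorem differentiableOn_bean_cube : DifferentiableOn ℂ (fun z => bean (z ^ 3)) unitDisk :=
  differentiableOn_bean.comp (by fun_prop) fun _ hz => cube_mem_unitDisk hz

theorem differentiableOn_bean_cube_sub_one_div :
    DifferentiableOn ℂ (fun u => (bean (u ^ 3) - 1) / u) unitDisk := by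
  refine ((differentiableOn_dslope unitDisk_mem_nhds).2 differentiableOn_bean_cube).congr ?_
  intro u _
  -- At the origin the quotient has the default value 0/0 = 0. This is the right value for the
  -- removable singularity, because u³ has derivative 0 there.
  rcases eq_or_ne u 0 with rfl | hu
  · have hb : DifferentiableAt ℂ bean ((0 : ℂ) ^ 3) := by
      simpa using differentiableOn_bean.differentiableAt unitDisk_mem_nhds
    have := (hb.hasDerivAt.comp (0 : ℂ) (hasDerivAt_pow 3 (0 : ℂ))).deriv
    simp only [dslope_same, div_zero]
    exact (by simpa [Function.comp_def] using this.symm)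
  · rw [dslope_of_ne _ hu, slope_def_field]
    simp [bean_zero]

theorem hasDerivAt_extremalFun {z : ℂ} (hz : z ∈ unitDisk) :
    HasDerivAt extremalFun
      (exp (segIntegral (fun u => (bean (u ^ 3) - 1) / u) z)) z := by
  refine hasDerivAt_segIntegral
    (g := fun t => exp (segIntegral (fun u => (bean (u ^ 3) - 1) / u) t)) (fun y hy => ?_) hz
  exact (hasDerivAt_segIntegral differentiableOn_bean_cube_sub_one_div hy).cexp
    |>.differentiableAt.differentiableWithinAt

theorem extremalFun_relation {z : ℂ} (hz : z ∈ unitDisk) :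
    1 + z * deriv (deriv extremalFun) z / deriv extremalFun z = bean (z ^ 3) := by
  have h2 : deriv (deriv extremalFun) z = deriv extremalFun z * ((bean (z ^ 3) - 1) / z) := by
    rw [(hasDerivAt_extremalFun hz).deriv]
    refine HasDerivAt.deriv (HasDerivAt.congr_of_eventuallyEq
      (hasDerivAt_segIntegral differentiableOn_bean_cube_sub_one_div hz).cexp ?_)
    filter_upwards [isOpen_ball.mem_nhds hz] with y hy using (hasDerivAt_extremalFun hy).deriv
  have h1 : deriv extremalFun z ≠ 0 := by
    rw [(hasDerivAt_extremalFun hz).deriv]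
    exact exp_ne_zero _
  rw [h2]
  rcases eq_or_ne z 0 with rfl | h0
  · simp [bean_zero]
  · field_simp
    ring

theorem extremalFun_mem_classCB : extremalFun ∈ classCB := by
  refine ⟨⟨fun z hz => (hasDerivAt_extremalFun hz).differentiableAt.differentiableWithinAt,
    by simp [extremalFun, segIntegral], ?_⟩, fun z hz => ?_, ?_, differentiableOn_bean,
    fun z => z ^ 3, isSchwarz_cube, fun z hz => extremalFun_relation hz⟩
  · rw [(hasDerivAt_extremalFun zero_mem_unitDisk).deriv]
    simp [segIntegral]
  · rw [(hasDerivAt_extremalFun hz).deriv]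
    exact exp_ne_zero _
  · exact differentiableOn_bean_cube.congr fun z hz => extremalFun_relation hz

/-! ### The Hankel determinant: bound and equality -/

theorem hankelDet_eq {f w : ℂ → ℂ} (hf : f ∈ classA) (hf' : ∀ z ∈ unitDisk, deriv f z ≠ 0)
    (hw : IsSchwarz w)
    (h : ∀ z ∈ unitDisk, 1 + z * deriv (deriv f) z / deriv f z = bean (w z)) :
    576 * hankelDet f 2 3 =
      3 / 5 * (4 * coeff w 2 + coeff w 1 ^ 2) * (coeff w 4 / 2 + coeff w 1 * coeff w 3 / 12
        - 5 / 12 * coeff w 1 ^ 2 * coeff w 2 - 11 / 288 * coeff w 1 ^ 4)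
      - (coeff w 3 + coeff w 1 * coeff w 2 / 4 - 13 / 48 * coeff w 1 ^ 3) ^ 2 := by
  obtain ⟨hfd, -, hf1⟩ := hf
  obtain ⟨hwd, hw0, hwb⟩ := hw
  have hmem : ∀ z ∈ unitDisk, w z ∈ unitDisk := fun z hz => by
    rw [unitDisk, mem_ball_zero_iff] at *
    exact (hwb z (mem_ball_zero_iff.2 hz)).trans_lt hz
  obtain ⟨h3, h4, h5⟩ := coeff_formulas (p := fun z => bean (w z))
    (hfd.analyticAt unitDisk_mem_nhds) (hwd.analyticAt unitDisk_mem_nhds)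
    ((differentiableOn_bean.comp hwd hmem).analyticAt unitDisk_mem_nhds) hf1 hw0
    (by simp [hw0, bean_zero])
    (by filter_upwards [unitDisk_mem_nhds] with z hz using bean_mul_self (hmem z hz))
    (by
      filter_upwards [unitDisk_mem_nhds] with z hz
      have := hf' z hz
      rw [← h z hz]
      field_simp
      ring)
  rw [hankelDet_two_three, h3, h4, h5]
  ring

theorem norm_hankelDet_le {f : ℂ → ℂ} (hf : f ∈ classCB) : ‖hankelDet f 2 3‖ ≤ 1 / 576 := by
  obtain ⟨hfA, hf', -, -, w, hw, h⟩ := hf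
  have he := congrArg norm (hankelDet_eq hfA hf' hw h)
  have hs := hw.sum_sq_norm_coeff_le 5
  simp only [Finset.sum_range_succ, Finset.sum_range_zero, coeff_zero_eq w, hw.2.1] at hs
  have hb := hankel_real_bound (c := ‖coeff w 1‖) (x := ‖coeff w 2‖) (u := ‖coeff w 3‖)
    (v := ‖coeff w 4‖) (norm_nonneg _) (norm_nonneg _) (by simpa using hs)
  have h1 : ‖4 * coeff w 2 + coeff w 1 ^ 2‖ ≤ 4 * ‖coeff w 2‖ + ‖coeff w 1‖ ^ 2 :=
    (norm_add_le _ _).trans_eq (by simp)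
  have h2 : ‖coeff w 4 / 2 + coeff w 1 * coeff w 3 / 12 - 5 / 12 * coeff w 1 ^ 2 * coeff w 2
      - 11 / 288 * coeff w 1 ^ 4‖ ≤ ‖coeff w 4‖ / 2 + ‖coeff w 1‖ * ‖coeff w 3‖ / 12
        + 5 / 12 * ‖coeff w 1‖ ^ 2 * ‖coeff w 2‖ + 11 / 288 * ‖coeff w 1‖ ^ 4 := by
    refine (norm_sub_le _ _).trans (add_le_add ((norm_sub_le _ _).trans
      (add_le_add ((norm_add_le _ _).trans_eq ?_) ?_)) ?_) <;> simp
  have h3 : ‖coeff w 3 + coeff w 1 * coeff w 2 / 4 - 13 / 48 * coeff w 1 ^ 3‖ ≤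
      ‖coeff w 3‖ + ‖coeff w 1‖ * ‖coeff w 2‖ / 4 + 13 / 48 * ‖coeff w 1‖ ^ 3 := by
    refine (norm_sub_le _ _).trans (add_le_add ((norm_add_le _ _).trans_eq ?_) ?_) <;> simp
  have h4 : 576 * ‖hankelDet f 2 3‖ ≤ 1 := by
    calc 576 * ‖hankelDet f 2 3‖ = ‖576 * hankelDet f 2 3‖ := by simp
      _ ≤ _ := he.trans_le (norm_sub_le _ _)
      _ ≤ _ := by
        rw [norm_mul, norm_mul, norm_pow, show ‖(3 / 5 : ℂ)‖ = 3 / 5 by simp]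
        gcongr
      _ ≤ 1 := hb
  linarith

theorem coeff_cube (n : ℕ) : coeff (fun z => z ^ 3) n = if n = 3 then 1 else 0 := by
  have : (fun z : ℂ => z ^ 3) = (fun z => z) * ((fun z => z) * (fun z => z)) := by
    ext z
    simp only [Pi.mul_apply]
    ring
  rw [this, ← coeff_taylorSeries, taylorSeries_mul (by fun_prop) (by fun_prop),
    taylorSeries_mul (by fun_prop) (by fun_prop), taylorSeries_id, ← PowerSeries.coeff_X_pow]
  congr 1
  ring

theorem norm_hankelDet_extremalFun : ‖hankelDet extremalFun 2 3‖ = 1 / 576 := by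
  have h := hankelDet_eq extremalFun_mem_classCB.1 extremalFun_mem_classCB.2.1 isSchwarz_cube
    fun z hz => extremalFun_relation hz
  simp only [coeff_cube] at h
  -- For w = z³ only b₃ = 1 is nonzero, so only the term -b₃² of 576 H₂(3) survives.
  have h2 : hankelDet extremalFun 2 3 = -(1 / 576) := by
    norm_num at h
    linear_combination h / 576
  rw [h2]
  simp

end BeanConvex

theorem mainTheorem4 :
    (∀ f ∈ BeanConvex.classCB, ‖BeanConvex.hankelDet f 2 3‖ ≤ 1 / 576) ∧
      BeanConvex.extremalFun ∈ BeanConvex.classCB ∧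
      ‖BeanConvex.hankelDet BeanConvex.extremalFun 2 3‖ = 1 / 576 :=
  ⟨fun _ hf => BeanConvex.norm_hankelDet_le hf, BeanConvex.extremalFun_mem_classCB,
    BeanConvex.norm_hankelDet_extremalFun⟩
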